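/- Let $0<p<1$ and $q=1-p$. Label the nearest-neighbour edges of the first quadrant $\mathbb{Z}_{\ge 0}^2$ by $0$ or $1$ as follows. The labels on the $x$-axis are $1$ with probability $p$ and $0$ with probability $q$, those on the $y$-axis are $1$ with probability $q$ and $0$ with probability $p$, and all these labels are independent. Then, strip after strip from bottom to top, and in each strip $[0,\infty)\times[m,m+1]$ square after square from left to right, give labels to the upper and the right edge of the square such that label(lower) + label(right) = label(left) + label(upper). If there are two ways to do so, choose one of them by an independent fair coin. Then the following hold. (a) There is exactly one measure $\mu$ on the $\{0,1\}$-labellings $c$ of all edges of $\mathbb{Z}^2$ whose marginal on each quadrant $(a,b)+\mathbb{Z}_{\ge 0}^2$, $(a,b)\in\mathbb{Z}^2$, is (after translation) the law of this random labelling. (b) Let $\pi=(\dots,z_{-1},z_0,z_1,\dots)$ be a bi-infinite nearest-neighbour path in $\mathbb{Z}^2$, $z_k=(z_{k,1},z_{k,2})$, such that $z_{k,1}$ is non-decreasing and $z_{k,2}$ is non-increasing in $k$, and let $e_i$ be the edge $(z_i,z_{i+1})$. Then under $\mu$ the labels $(\dots,c(e_{-1}),c(e_0),c(e_1),\dots)$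 are independent. (c) Suppose moreover that $\pi$ is unbounded in all four directions (both coordinates are unbounded above and below along $\pi$). Then $\mu$ is the law of the following labelling. Label the edges of $\pi$ independently, a horizontal edge being $1$ with probability $p$ and a vertical edge with probability $q$. Take an independent fair coin for each square of the lattice. Complete each square above $\pi$ from the labels of its lower and left edges, and each square below $\pi$ from the labels of its upper and right edges, so that label(lower) + label(right) = label(left) + label(upper), where, if there are two ways to do so, both new labels are equal to the coin (with values $0$, $1$) of the square. For any given labels on $\pi$ and any given coins there is exactly one labelling of the plane that satisfies these rules, and it is a measurable function of them. -/

import Mathlib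

open MeasureTheory ProbabilityTheory

namespace CocycleExample

/-- Nearest-neighbour edges of the square lattice (`α = ℤ`) or of its first quadrant (`α = ℕ`):
`hor x y` joins `(x, y)` to `(x + 1, y)` and `ver x y` joins `(x, y)` to `(x, y + 1)`. -/
inductive Edge (α : Type) : Type
  | hor (x y : α) : Edge α
  | ver (x y : α) : Edge α

/-- A labelling of the edges; `true` is the label 1 and `false` is the label 0. The space of
labellings carries the product σ-algebra. -/
abbrev Labelling (α : Type) : Type := Edge α → Bool

/-- Completion of a square two of whose labels are given. If `a` is the label of the lower edge,
`b` the label of the left edge and `κ` a coin, the result is the pair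
(label of the upper edge, label of the right edge).
If, conversely, `a` is the label of the upper edge and `b` the label of the right edge, the result
is the pair (label of the lower edge, label of the left edge).
The coin is used only if there are two possible completions. -/
def complete (a b κ : Bool) : Bool × Bool :=
  if a = b then (κ, κ) else (a, b)

/-- `complete` produces exactly the pairs (upper label `t`, right label `r`) for which the sum of
the labels along the two up-right routes around the square agree. -/
theorem complete_forward (a b t r : Bool) :
    (∃ κ, complete a b κ = (t, r)) ↔ a.toNat + r.toNat = b.toNat + t.toNat := by
  revert a b t r; decide

/-- The same for the completion of a square from its upper label `t` and right label `r`. -/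
theorem complete_backward (a b t r : Bool) :
    (∃ κ, complete t r κ = (a, b)) ↔ a.toNat + r.toNat = b.toNat + t.toNat := by
  revert a b t r; decide

/-- Where there are two possible completions, each corresponds to one value of the coin. -/
theorem complete_coin (a b : Bool) (h : ∃ κ κ', complete a b κ ≠ complete a b κ') :
    Function.Injective (complete a b) := by
  revert a b; decide

section Quadrant

/-- Labels of the vertical edges of a horizontal strip, from left to right, given the labels
`bottom` of the lower edges, the label `left` of the leftmost vertical edge, and the coins. -/
def stripVertical (bottom : ℕ → Bool) (left : Bool) (coin : ℕ → Bool) : ℕ → Bool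
  | 0 => left
  | n + 1 => (complete (bottom n) (stripVertical bottom left coin n) (coin n)).2

/-- Labels of the upper edges of the strip. -/
def stripTop (bottom : ℕ → Bool) (left : Bool) (coin : ℕ → Bool) (n : ℕ) : Bool :=
  (complete (bottom n) (stripVertical bottom left coin n) (coin n)).1

/-- Labels of the horizontal edges at height `m`, strip after strip; `X` are the labels on the
`x`-axis, `Y` those on the `y`-axis and `coin (n, m)` belongs to `[n, n + 1] × [m, m + 1]`. -/
def rowLabels (X Y : ℕ → Bool) (coin : ℕ × ℕ → Bool) : ℕ → ℕ → Bool
  | 0 => X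
  | m + 1 => stripTop (rowLabels X Y coin m) (Y m) (fun n => coin (n, m))

/-- The labelling of all edges of the first quadrant produced by the procedure. -/
def quadrantFill (s : (ℕ → Bool) × (ℕ → Bool) × (ℕ × ℕ → Bool)) : Labelling ℕ
  | .hor x y => rowLabels s.1 s.2.1 s.2.2 y x
  | .ver x y => stripVertical (rowLabels s.1 s.2.1 s.2.2 y) (s.2.1 y) (fun n => s.2.2 (n, y)) x

/-- The procedure is measurable, so that it has a law. -/
theorem measurable_quadrantFill : Measurable quadrantFill := by
  have hc : Measurable fun t : Bool × Bool × Bool => complete t.1 t.2.1 t.2.2 :=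
    measurable_of_countable _
  have coin : ∀ n m : ℕ, Measurable
      fun s : (ℕ → Bool) × (ℕ → Bool) × (ℕ × ℕ → Bool) => s.2.2 (n, m) := fun n m => by fun_prop
  have hv : ∀ y, (∀ x, Measurable fun s : (ℕ → Bool) × (ℕ → Bool) × (ℕ × ℕ → Bool) =>
      rowLabels s.1 s.2.1 s.2.2 y x) → ∀ x, Measurable
      fun s : (ℕ → Bool) × (ℕ → Bool) × (ℕ × ℕ → Bool) =>
      stripVertical (rowLabels s.1 s.2.1 s.2.2 y) (s.2.1 y) (fun n => s.2.2 (n, y)) x := by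
    intro y hy x
    induction x with
    | zero => simp only [stripVertical]; fun_prop
    | succ n ih =>
      exact measurable_snd.comp (hc.comp ((hy n).prodMk (ih.prodMk (coin n y))))
  have hh : ∀ y x, Measurable fun s : (ℕ → Bool) × (ℕ → Bool) × (ℕ × ℕ → Bool) =>
      rowLabels s.1 s.2.1 s.2.2 y x := by
    intro y
    induction y with
    | zero => intro x; simp only [rowLabels]; fun_prop
    | succ m ih =>
      intro x
      exact measurable_fst.comp (hc.comp ((ih x).prodMk ((hv m ih x).prodMk (coin x m))))
  refine measurable_pi_iff.2 fun e => ?_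
  cases e with
  | hor x y => exact hh y x
  | ver x y => exact hv y (hh y) x

end Quadrant

/-- The law of a label that is 1 with probability `p` and 0 with probability `1 - p`. -/
noncomputable def labelLaw (p : unitInterval) : Measure Bool :=
  bernoulliMeasure true false p

instance (p : unitInterval) : IsProbabilityMeasure (labelLaw p) := by
  unfold labelLaw; infer_instance

/-- The law of a fair coin. -/
noncomputable def fairCoin : Measure Bool :=
  labelLaw ⟨1 / 2, by norm_num, by norm_num⟩

instance : IsProbabilityMeasure fairCoin := by
  unfold fairCoin; infer_instance

/-- The law of the random labelling of the first quadrant: the labels on the `x`-axis are 1 with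
probability `p`, those on the `y`-axis are 1 with probability `1 - p`, the coins are fair, and all
these variables are independent. -/
noncomputable def quadrantLaw (p : unitInterval) : Measure (Labelling ℕ) :=
  ((Measure.infinitePi fun _ : ℕ => labelLaw p).prod
    ((Measure.infinitePi fun _ : ℕ => labelLaw (unitInterval.symm p)).prod
      (Measure.infinitePi fun _ : ℕ × ℕ => fairCoin))).map quadrantFill

/-- The labels which `c` gives to the edges of the quadrant with lower left corner `(a, b)`, seen
as a labelling of the first quadrant. -/
def quadrantAt (a b : ℤ) (c : Labelling ℤ) : Labelling ℕ
  | .hor x y => c (.hor (a + x) (b + y))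
  | .ver x y => c (.ver (a + x) (b + y))

/-- `μ` is the extension to the whole plane of the law of the labelling of the first quadrant:
its marginal on each translate of the first quadrant is that law. -/
def IsPlaneExtension (p : unitInterval) (μ : Measure (Labelling ℤ)) : Prop :=
  ∀ a b : ℤ, μ.map (quadrantAt a b) = quadrantLaw p

/-- A bi-infinite nearest-neighbour path in the square lattice with non-decreasing first
coordinates and non-increasing second coordinates. -/
structure IsDirectedPath (z : ℤ → ℤ × ℤ) : Prop where
  adjacent : ∀ i, |(z (i + 1)).1 - (z i).1| + |(z (i + 1)).2 - (z i).2| = 1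
  fst_monotone : Monotone fun i => (z i).1
  snd_antitone : Antitone fun i => (z i).2

/-- The edge joining two adjacent vertices `u` and `w`. -/
def edgeBetween (u w : ℤ × ℤ) : Edge ℤ :=
  if u.2 = w.2 then .hor (min u.1 w.1) u.2 else .ver u.1 (min u.2 w.2)

/-- The edge `e_i` between the vertices `z_i` and `z_{i+1}`. -/
def pathEdge (z : ℤ → ℤ × ℤ) (i : ℤ) : Edge ℤ := edgeBetween (z i) (z (i + 1))

/-- The path is unbounded in all four directions. -/
structure IsUnboundedPath (z : ℤ → ℤ × ℤ) : Prop where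
  right : ∀ n : ℤ, ∃ i, n ≤ (z i).1
  left : ∀ n : ℤ, ∃ i, (z i).1 ≤ n
  up : ∀ n : ℤ, ∃ i, n ≤ (z i).2
  down : ∀ n : ℤ, ∃ i, (z i).2 ≤ n

/-- The square `[x, x + 1] × [y, y + 1]` lies above (north-east of) the directed path. -/
def SquareAbove (z : ℤ → ℤ × ℤ) (x y : ℤ) : Prop :=
  ∃ i, (z i).1 ≤ x ∧ (z i).2 ≤ y

/-- The square `[x, x + 1] × [y, y + 1]` lies below (south-west of) the directed path. -/
def SquareBelow (z : ℤ → ℤ × ℤ) (x y : ℤ) : Prop :=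
  ∃ i, x + 1 ≤ (z i).1 ∧ y + 1 ≤ (z i).2

/-- `c` is the labelling obtained by filling the plane from the path: `c` has the labels `l` on
the path, squares above the path are completed from their lower and left edges, and squares below
the path from their upper and right edges, with the help of one coin for each square. -/
structure IsFilling (z : ℤ → ℤ × ℤ) (l : ℤ → Bool) (coin : ℤ × ℤ → Bool) (c : Labelling ℤ) :
    Prop where
  on_path : ∀ i, c (pathEdge z i) = l i
  above : ∀ x y, SquareAbove z x y →
    (c (.hor x (y + 1)), c (.ver (x + 1) y)) = complete (c (.hor x y)) (c (.ver x y)) (coin (x, y))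
  below : ∀ x y, SquareBelow z x y →
    (c (.hor x y), c (.ver x y)) =
      complete (c (.hor x (y + 1))) (c (.ver (x + 1) y)) (coin (x, y))

/-- The one-dimensional marginals: a horizontal edge has label 1 with probability `p`, a vertical
edge with probability `1 - p`. -/
noncomputable def edgeLaw (p : unitInterval) : Edge ℤ → Measure Bool
  | .hor _ _ => labelLaw p
  | .ver _ _ => labelLaw (unitInterval.symm p)

instance (p : unitInterval) (e : Edge ℤ) : IsProbabilityMeasure (edgeLaw p e) := by
  cases e <;> (unfold edgeLaw; infer_instance)

/-- The joint law of labels on the path, independent with the correct marginals, and of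
independent fair coins for all squares of the plane. -/
noncomputable def pathSourceLaw (p : unitInterval) (z : ℤ → ℤ × ℤ) :
    Measure ((ℤ → Bool) × (ℤ × ℤ → Bool)) :=
  (Measure.infinitePi fun i : ℤ => edgeLaw p (pathEdge z i)).prod
    (Measure.infinitePi fun _ : ℤ × ℤ => fairCoin)

end CocycleExample

/-! The core is a symmetry of one square. If the lower label `a`, the left label `b` and the coin
`κ` are independent with parameters `p`, `1 - p` and `1/2`, so are the upper label, the right label
and a new coin that equals `a` when `a = b` and `κ` otherwise. Indeed this substitution (`twist`) is
an involution. It fixes triples with `a ≠ b` and sends `(a, a, κ)` to `(κ, κ, a)`, and the pairs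
`(1, 1)` and `(0, 0)` both have weight `p (1 - p)` (`infinitePi_map_twist`). The new coin is exactly
the one that completes the square backwards to `(a, b)`.

An interface is the boundary of a lower set `D` of squares that is proper and non-empty in every row
and column. Labels on the boundary and coins determine a labelling of the plane
(`IsInterface.exists_fill`). By the symmetry, its law does not change when `D` gains one square
(`IsInterface.law_insert`), hence under finitely many moves (`IsInterface.law_eq_of_finite`). Moving
the boundary to the left and lower sides of a large box shows that every quadrant marginal is the
prescribed one (`IsInterface.isPlaneExtension_law`). This gives existence. Uniqueness holds since
finitely many edges always lie in one quadrant.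

So all interfaces produce the same measure. A finite piece of a directed path lies on some
interface, where labels are independent by construction. A path unbounded in all four directions is
itself an interface, which gives the description by filling. -/

namespace CocycleExample

/-! ### Product measures: finite-dimensional marginals and disjoint families of coordinates. -/

section Product

variable {I J K X : Type*} [MeasurableSpace X]

/-- A finite measure on a product space is determined by its finite-dimensional marginals. -/
theorem ext_of_map_restrict {μ ν : Measure (I → X)} [IsFiniteMeasure ν]
    (h : ∀ s : Finset I, μ.map s.restrict = ν.map s.restrict) : μ = ν :=
  IsProjectiveLimit.unique (P := fun s : Finset I => ν.map s.restrict) h fun _ => rfl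

/-- Two measures on `I → Bool` agree if they agree on the cylinders over points, for all large
finite sets of coordinates. -/
theorem ext_of_pointCylinders {μ ν : Measure (I → Bool)} [IsFiniteMeasure ν] (s₀ : Finset I)
    (h : ∀ s : Finset I, s₀ ⊆ s → ∀ v : I → Bool,
      μ {ω | ∀ i ∈ s, ω i = v i} = ν {ω | ∀ i ∈ s, ω i = v i}) : μ = ν := by
  classical
  have key : ∀ s : Finset I, s₀ ⊆ s → μ.map s.restrict = ν.map s.restrict := by
    intro s hs
    refine Measure.ext_of_singleton fun w => ?_
    obtain ⟨v, rfl⟩ : ∃ v : I → Bool, s.restrict v = w :=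
      ⟨fun i => if hi : i ∈ s then w ⟨i, hi⟩ else false, by ext i; simp⟩
    have hpre : (s.restrict : (I → Bool) → _) ⁻¹' {(s.restrict v : s → Bool)} = {ω : I → Bool | ∀ i ∈ s, ω i = v i} := by
      ext ω
      simp [funext_iff]
    rw [Measure.map_apply (by fun_prop) (measurableSet_singleton _),
      Measure.map_apply (by fun_prop) (measurableSet_singleton _), hpre]
    exact h s hs v
  refine ext_of_map_restrict fun s => ?_
  have hr : (s.restrict : (I → Bool) → _) =
      Finset.restrict₂ (π := fun _ => Bool) (Finset.subset_union_left : s ⊆ s ∪ s₀) ∘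
        (s ∪ s₀).restrict := rfl
  rw [hr, ← Measure.map_map (by fun_prop) (by fun_prop),
    ← Measure.map_map (by fun_prop) (by fun_prop), key _ Finset.subset_union_right]

/-- The joint law of two disjoint families of coordinates under a product measure. -/
theorem infinitePi_map_prodMk {P : I → Measure X} [∀ i, IsProbabilityMeasure (P i)]
    {f : J → I} {g : K → I} (h : Function.Injective (Sum.elim f g)) :
    (Measure.infinitePi P).map (fun ω => (fun j => ω (f j), fun k => ω (g k))) =
      (Measure.infinitePi fun j => P (f j)).prod (Measure.infinitePi fun k => P (g k)) := by
  classical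
  have hsum : ((Measure.infinitePi fun j => P (f j)).prod (Measure.infinitePi fun k => P (g k))).map
      (fun a : (J → X) × (K → X) => (fun t : J ⊕ K => Sum.elim a.1 a.2 t)) =
      Measure.infinitePi fun t : J ⊕ K => P (Sum.elim f g t) := by
    have hm : Measurable (fun a : (J → X) × (K → X) => (fun t : J ⊕ K => Sum.elim a.1 a.2 t)) := by
      refine measurable_pi_iff.2 fun t => ?_
      cases t <;> simp only [Sum.elim_inl, Sum.elim_inr] <;> fun_prop
    refine Measure.eq_infinitePi _ fun s t ht => ?_
    rw [Measure.map_apply hm (.pi s.countable_toSet fun _ _ => ht _)]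
    have hpre : (fun a : (J → X) × (K → X) => (fun t : J ⊕ K => Sum.elim a.1 a.2 t)) ⁻¹'
        ((s : Set (J ⊕ K)).pi t) =
        ((s.toLeft : Set J).pi fun j => t (.inl j)) ×ˢ
          ((s.toRight : Set K).pi fun k => t (.inr k)) := by
      ext a
      simp [Set.mem_pi]
    rw [hpre, Measure.prod_prod, Measure.infinitePi_pi _ fun i _ => ht _,
      Measure.infinitePi_pi _ fun i _ => ht _]
    conv_rhs => rw [← Finset.toLeft_disjSum_toRight (u := s), Finset.prod_disjSum]
    rfl
  have hsplit : Measurable fun ω : J ⊕ K → X =>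
      ((fun j => ω (.inl j), fun k => ω (.inr k)) : (J → X) × (K → X)) := by fun_prop
  have hm : Measurable (fun a : (J → X) × (K → X) => (fun t : J ⊕ K => Sum.elim a.1 a.2 t)) := by
    refine measurable_pi_iff.2 fun t => ?_
    cases t <;> simp only [Sum.elim_inl, Sum.elim_inr] <;> fun_prop
  -- Reindexing along the injection `Sum.elim f g` gives the product measure over `J ⊕ K`, which
  -- then splits by `hsum`.
  have h1 := Measure.map_infinitePi_infinitePi_of_inj (P := P) h
  have h2 := congrArg (Measure.map fun ω : J ⊕ K → X =>
      ((fun j => ω (.inl j), fun k => ω (.inr k)) : (J → X) × (K → X))) (h1.trans hsum.symm)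
  rw [Measure.map_map hsplit (by fun_prop), Measure.map_map hsplit hm] at h2
  exact h2.trans Measure.map_id

end Product

/-! ### The measure-preserving involution of a single square. -/

section Twist

theorem labelLaw_singleton_true (p : unitInterval) :
    labelLaw p {true} = unitInterval.toNNReal p := by
  unfold labelLaw
  rw [bernoulliMeasure_apply_of_mem_of_notMem p (measurableSet_singleton _) (by simp) (by simp)]

theorem labelLaw_singleton_false (p : unitInterval) :
    labelLaw p {false} = unitInterval.toNNReal (unitInterval.symm p) := by
  unfold labelLaw
  rw [bernoulliMeasure_apply_of_notMem_of_mem p (measurableSet_singleton _) (by simp) (by simp)]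

theorem fairCoin_singleton (κ κ' : Bool) : fairCoin {κ} = fairCoin {κ'} := by
  have : fairCoin {true} = fairCoin {false} := by
    unfold fairCoin
    rw [labelLaw_singleton_true, labelLaw_singleton_false]
    congr 2
    ext
    norm_num
  cases κ <;> cases κ' <;> simp [this]

open scoped Classical in
/-- Replace the labels at `i` and `j` by the completion of the square with these labels and the
coin at `k`, and store in the coin what is needed to undo this. -/
noncomputable def twist {I : Type*} (i j k : I) (ω : I → Bool) : I → Bool := fun x =>
  if x = i then (complete (ω i) (ω j) (ω k)).1
  else if x = j then (complete (ω i) (ω j) (ω k)).2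
  else if x = k then (if ω i = ω j then ω i else ω k)
  else ω x

variable {I : Type*} {i j k : I}

theorem twist_fst (ω : I → Bool) : twist i j k ω i = (complete (ω i) (ω j) (ω k)).1 := by
  simp [twist]

theorem twist_snd (hij : i ≠ j) (ω : I → Bool) :
    twist i j k ω j = (complete (ω i) (ω j) (ω k)).2 := by
  simp [twist, hij.symm]

theorem twist_coin (hik : i ≠ k) (hjk : j ≠ k) (ω : I → Bool) :
    twist i j k ω k = if ω i = ω j then ω i else ω k := by
  simp [twist, hik.symm, hjk.symm]

theorem twist_of_ne {x : I} (hi : x ≠ i) (hj : x ≠ j) (hk : x ≠ k) (ω : I → Bool) :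
    twist i j k ω x = ω x := by
  simp [twist, hi, hj, hk]

theorem measurable_twist : Measurable (twist i j k) := by
  have hg : ∀ g : Bool × Bool × Bool → Bool,
      Measurable fun ω : I → Bool => g (ω i, ω j, ω k) := fun g =>
    (measurable_of_countable g).comp (by fun_prop)
  refine measurable_pi_iff.2 fun x => ?_
  unfold twist
  split_ifs
  · exact hg fun t => (complete t.1 t.2.1 t.2.2).1
  · exact hg fun t => (complete t.1 t.2.1 t.2.2).2
  · exact hg fun t => if t.1 = t.2.1 then t.1 else t.2.2
  · fun_prop

theorem twist_twist (hij : i ≠ j) (hik : i ≠ k) (hjk : j ≠ k) (ω : I → Bool) :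
    twist i j k (twist i j k ω) = ω := by
  ext x
  have key : ∀ a b c : Bool,
      complete (complete a b c).1 (complete a b c).2 (if a = b then a else c) = (a, b) ∧
      (if (complete a b c).1 = (complete a b c).2 then (complete a b c).1
        else (if a = b then a else c)) = c := by decide
  obtain ⟨h1, h2⟩ := key (ω i) (ω j) (ω k)
  by_cases hi : x = i
  · subst hi
    rw [twist_fst, twist_fst, twist_snd hij, twist_coin hik hjk, h1]
  by_cases hj : x = j
  · subst hj
    rw [twist_snd hij, twist_fst, twist_snd hij, twist_coin hik hjk, h1]
  by_cases hk : x = k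
  · subst hk
    rw [twist_coin hik hjk, twist_fst, twist_snd hij, twist_coin hik hjk, h2]
  rw [twist_of_ne hi hj hk, twist_of_ne hi hj hk]

/-- Completing a square preserves the joint law of its two given labels and of the coin. -/
theorem infinitePi_map_twist {P : I → Measure Bool} [∀ i, IsProbabilityMeasure (P i)]
    (p : unitInterval) (hij : i ≠ j) (hik : i ≠ k) (hjk : j ≠ k)
    (hi : P i = labelLaw p) (hj : P j = labelLaw (unitInterval.symm p)) (hk : P k = fairCoin) :
    (Measure.infinitePi P).map (twist i j k) = Measure.infinitePi P := by
  classical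
  refine ext_of_pointCylinders {i, j, k} fun s hs v => ?_
  have hcyl : ∀ v : I → Bool, MeasurableSet {ω : I → Bool | ∀ i ∈ s, ω i = v i} := fun v => by
    have : {ω : I → Bool | ∀ i ∈ s, ω i = v i} = (s : Set I).pi fun i => {v i} := by
      ext; simp [Set.mem_pi]
    rw [this]
    exact .pi s.countable_toSet fun _ _ => measurableSet_singleton _
  have hval : ∀ v : I → Bool, Measure.infinitePi P {ω : I → Bool | ∀ i ∈ s, ω i = v i} =
      ∏ i ∈ s, P i {v i} := fun v => by
    rw [← Measure.infinitePi_pi P fun i _ => measurableSet_singleton (v i)]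
    congr 1
  have hlocal : ∀ ω w : I → Bool, (∀ x ∈ s, ω x = w x) →
      ∀ x ∈ s, twist i j k ω x = twist i j k w x := by
    intro ω w h x hx
    have e1 := h i (hs (by simp))
    have e2 := h j (hs (by simp))
    have e3 := h k (hs (by simp))
    simp only [twist, e1, e2, e3, h x hx]
  -- Since `s` contains `i`, `j` and `k`, the involution maps point cylinders over `s` to point
  -- cylinders over `s`.
  have hpre : twist i j k ⁻¹' {ω : I → Bool | ∀ i ∈ s, ω i = v i} =
      {ω : I → Bool | ∀ x ∈ s, ω x = twist i j k v x} := by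
    ext ω
    refine ⟨fun h x hx => ?_, fun h x hx => ?_⟩
    · rw [← hlocal _ _ h x hx, twist_twist hij hik hjk]
    · rw [hlocal _ _ h x hx, twist_twist hij hik hjk]
  rw [Measure.map_apply measurable_twist (hcyl v), hpre, hval, hval,
    ← Finset.prod_sdiff hs, ← Finset.prod_sdiff hs]
  congr 1
  · refine Finset.prod_congr rfl fun x hx => ?_
    simp only [Finset.mem_sdiff, Finset.mem_insert, Finset.mem_singleton, not_or] at hx
    rw [twist_of_ne hx.2.1 hx.2.2.1 hx.2.2.2]
  · have h3 : ∀ f : I → ENNReal, ∏ x ∈ ({i, j, k} : Finset I), f x = f i * (f j * f k) := by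
      intro f
      rw [Finset.prod_insert (by simp [hij, hik]), Finset.prod_pair hjk]
    rw [h3, h3, twist_fst, twist_snd hij, twist_coin hik hjk, hi, hj, hk]
    generalize v i = a
    generalize v j = b
    generalize v k = c
    -- Both values of the coin have the same weight, so only the weights of the two label pairs
    -- remain to be compared.
    rw [fairCoin_singleton (if a = b then a else c) c]
    simp only [← mul_assoc]
    congr 1
    cases a <;> cases b <;> cases c <;>
      simp [complete, labelLaw_singleton_true, labelLaw_singleton_false, mul_comm]

end Twist

/-! ### Filling the plane from an interface. -/

section Filling

/-- The edges, which carry labels, and the squares, which carry coins. -/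
abbrev Site : Type := Edge ℤ ⊕ (ℤ × ℤ)

/-- A lower set of squares which is proper and non-empty in each row and each column. -/
structure IsInterface (D : Set (ℤ × ℤ)) : Prop where
  lower : IsLowerSet D
  left : ∀ y, ∃ x, (x, y) ∈ D
  right : ∀ y, ∃ x, (x, y) ∉ D
  down : ∀ x, ∃ y, (x, y) ∈ D
  up : ∀ x, ∃ y, (x, y) ∉ D

theorem _root_.IsLowerSet.mem_of_le {D : Set (ℤ × ℤ)} (hD : IsLowerSet D) {x y x' y' : ℤ}
    (h : (x, y) ∈ D) (hx : x' ≤ x) (hy : y' ≤ y) : (x', y') ∈ D :=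
  hD (show ((x', y') : ℤ × ℤ) ≤ (x, y) from ⟨hx, hy⟩) h

/-- `c` carries the labels `ω` on the boundary between `D` and its complement, the squares outside
`D` are completed forwards, and those in `D` backwards. -/
structure IsFilledFrom (D : Set (ℤ × ℤ)) (ω : Site → Bool) (c : Labelling ℤ) : Prop where
  hor : ∀ x y, (x, y - 1) ∈ D → (x, y) ∉ D → c (.hor x y) = ω (.inl (.hor x y))
  ver : ∀ x y, (x - 1, y) ∈ D → (x, y) ∉ D → c (.ver x y) = ω (.inl (.ver x y))
  above : ∀ x y, (x, y) ∉ D →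
    (c (.hor x (y + 1)), c (.ver (x + 1) y)) =
      complete (c (.hor x y)) (c (.ver x y)) (ω (.inr (x, y)))
  below : ∀ x y, (x, y) ∈ D →
    (c (.hor x y), c (.ver x y)) =
      complete (c (.hor x (y + 1))) (c (.ver (x + 1) y)) (ω (.inr (x, y)))

open scoped Classical in
/-- Recompute each label from the labels on which it depends. -/
noncomputable def refill (D : Set (ℤ × ℤ)) (ω : Site → Bool) (c : Labelling ℤ) : Labelling ℤ
  | .hor x y =>
    if (x, y) ∈ D then (complete (c (.hor x (y + 1))) (c (.ver (x + 1) y)) (ω (.inr (x, y)))).1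
    else if (x, y - 1) ∈ D then ω (.inl (.hor x y))
    else (complete (c (.hor x (y - 1))) (c (.ver x (y - 1))) (ω (.inr (x, y - 1)))).1
  | .ver x y =>
    if (x, y) ∈ D then (complete (c (.hor x (y + 1))) (c (.ver (x + 1) y)) (ω (.inr (x, y)))).2
    else if (x - 1, y) ∈ D then ω (.inl (.ver x y))
    else (complete (c (.hor (x - 1) y)) (c (.ver (x - 1) y)) (ω (.inr (x - 1, y)))).2

variable {D : Set (ℤ × ℤ)}

/-- Turns the filling rules into a fixed-point equation. As `D` is a lower set, each edge is
governed by exactly one rule: backward completion, boundary value or forward completion. -/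
theorem isFilledFrom_iff_refill_eq (hD : IsLowerSet D) (ω : Site → Bool) (c : Labelling ℤ) :
    IsFilledFrom D ω c ↔ refill D ω c = c := by
  constructor
  · intro h
    ext e
    cases e with
    | hor x y =>
      by_cases h1 : (x, y) ∈ D
      · simp only [refill, h1, if_true, ← h.below x y h1]
      by_cases h2 : (x, y - 1) ∈ D
      · simp only [refill, h1, h2, if_true, if_false, h.hor x y h2 h1]
      · have := h.above x (y - 1) h2
        rw [sub_add_cancel] at this
        simp only [refill, h1, h2, if_false, ← this]
    | ver x y =>
      by_cases h1 : (x, y) ∈ D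
      · simp only [refill, h1, if_true, ← h.below x y h1]
      by_cases h2 : (x - 1, y) ∈ D
      · simp only [refill, h1, h2, if_true, if_false, h.ver x y h2 h1]
      · have := h.above (x - 1) y h2
        rw [sub_add_cancel] at this
        simp only [refill, h1, h2, if_false, ← this]
  · intro h
    have hh : ∀ x y, refill D ω c (.hor x y) = c (.hor x y) := fun x y => congrFun h _
    have hv : ∀ x y, refill D ω c (.ver x y) = c (.ver x y) := fun x y => congrFun h _
    refine ⟨fun x y h1 h2 => ?_, fun x y h1 h2 => ?_, fun x y h1 => ?_, fun x y h1 => ?_⟩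
    · rw [← hh]
      simp only [refill, h1, h2, if_true, if_false]
    · rw [← hv]
      simp only [refill, h1, h2, if_true, if_false]
    · have h2 : (x, y + 1) ∉ D := fun h3 => h1 (hD.mem_of_le h3 le_rfl (by lia))
      have h3 : (x + 1, y) ∉ D := fun h3 => h1 (hD.mem_of_le h3 (by lia) le_rfl)
      rw [← hh x (y + 1), ← hv (x + 1) y]
      simp only [refill, h1, h2, h3, if_false, add_sub_cancel_right]
    · rw [← hh x y, ← hv x y]
      simp only [refill, h1, if_true]

/-- The label of `e` is determined after finitely many recomputations. -/
def Stabilizes (D : Set (ℤ × ℤ)) (e : Edge ℤ) : Prop :=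
  ∃ N, ∀ n ≥ N, ∀ ω c c', (refill D ω)^[n] c e = (refill D ω)^[n] c' e

theorem stabilizes_of_refill {e d d' : Edge ℤ} (hd : Stabilizes D d) (hd' : Stabilizes D d')
    (h : ∀ ω c c', c d = c' d → c d' = c' d' → refill D ω c e = refill D ω c' e) :
    Stabilizes D e := by
  obtain ⟨N, hN⟩ := hd
  obtain ⟨N', hN'⟩ := hd'
  refine ⟨max N N' + 1, fun n hn ω c c' => ?_⟩
  obtain ⟨m, rfl⟩ : ∃ m, n = m + 1 := ⟨n - 1, by lia⟩
  rw [Function.iterate_succ_apply', Function.iterate_succ_apply']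
  exact h _ _ _ (hN m (by lia) ω c c') (hN' m (by lia) ω c c')

theorem stabilizes_of_const {e : Edge ℤ} (h : ∀ ω c c', refill D ω c e = refill D ω c' e) :
    Stabilizes D e := by
  refine ⟨1, fun n hn ω c c' => ?_⟩
  obtain ⟨m, rfl⟩ : ∃ m, n = m + 1 := ⟨n - 1, by lia⟩
  rw [Function.iterate_succ_apply', Function.iterate_succ_apply']
  exact h _ _ _

theorem stabilizes_hor_boundary {x y : ℤ} (h1 : (x, y) ∉ D) (h2 : (x, y - 1) ∈ D) :
    Stabilizes D (.hor x y) :=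
  stabilizes_of_const fun ω c c' => by simp [refill, h1, h2]

theorem stabilizes_ver_boundary {x y : ℤ} (h1 : (x, y) ∉ D) (h2 : (x - 1, y) ∈ D) :
    Stabilizes D (.ver x y) :=
  stabilizes_of_const fun ω c c' => by simp [refill, h1, h2]

theorem stabilizes_above (hD : IsLowerSet D) {x y : ℤ} (h : (x, y) ∉ D)
    (hh : Stabilizes D (.hor x y)) (hv : Stabilizes D (.ver x y)) :
    Stabilizes D (.hor x (y + 1)) ∧ Stabilizes D (.ver (x + 1) y) := by
  have h2 : (x, y + 1) ∉ D := fun h3 => h (hD.mem_of_le h3 le_rfl (by lia))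
  have h3 : (x + 1, y) ∉ D := fun h3 => h (hD.mem_of_le h3 (by lia) le_rfl)
  exact ⟨stabilizes_of_refill hh hv fun ω c c' e1 e2 => by simp [refill, h, h2, e1, e2],
    stabilizes_of_refill hh hv fun ω c c' e1 e2 => by simp [refill, h, h3, e1, e2]⟩

theorem stabilizes_below {x y : ℤ} (h : (x, y) ∈ D)
    (hh : Stabilizes D (.hor x (y + 1))) (hv : Stabilizes D (.ver (x + 1) y)) :
    Stabilizes D (.hor x y) ∧ Stabilizes D (.ver x y) :=
  ⟨stabilizes_of_refill hh hv fun ω c c' e1 e2 => by simp [refill, h, e1, e2],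
    stabilizes_of_refill hh hv fun ω c c' e1 e2 => by simp [refill, h, e1, e2]⟩

/-- Following dependencies down and to the left from a square outside `D`, one meets the boundary
after boundedly many steps, because the row and the column of the square both meet `D`. -/
theorem IsInterface.stabilizes_of_notMem (hD : IsInterface D) {x y : ℤ} (h : (x, y) ∉ D) :
    Stabilizes D (.hor x y) ∧ Stabilizes D (.ver x y) := by
  obtain ⟨x₀, hx₀⟩ := hD.left y
  obtain ⟨y₀, hy₀⟩ := hD.down x
  -- A square outside `D` and south-west of `(x, y)` has `x₀ < x'` and `y₀ < y'`, so the quantity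
  -- bounded by `n` is positive and the case `n = 0` is void.
  have key : ∀ n : ℕ, ∀ x' y', x' ≤ x → y' ≤ y → (x' - x₀) + (y' - y₀) ≤ n → (x', y') ∉ D →
      Stabilizes D (.hor x' y') ∧ Stabilizes D (.ver x' y') := by
    intro n
    induction n with
    | zero =>
      intro x' y' hx hy hn hD'
      have h1 : ¬ x' ≤ x₀ := fun h' => hD' (hD.lower.mem_of_le hx₀ h' hy)
      have h2 : ¬ y' ≤ y₀ := fun h' => hD' (hD.lower.mem_of_le hy₀ hx h')
      lia
    | succ n ih =>
      intro x' y' hx hy hn hD'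
      constructor
      · by_cases h2 : (x', y' - 1) ∈ D
        · exact stabilizes_hor_boundary hD' h2
        · obtain ⟨h3, h4⟩ := ih x' (y' - 1) hx (by lia) (by push_cast at hn; lia) h2
          simpa using (stabilizes_above hD.lower h2 h3 h4).1
      · by_cases h2 : (x' - 1, y') ∈ D
        · exact stabilizes_ver_boundary hD' h2
        · obtain ⟨h3, h4⟩ := ih (x' - 1) y' (by lia) hy (by push_cast at hn; lia) h2
          simpa using (stabilizes_above hD.lower h2 h3 h4).2
  exact key ((x - x₀) + (y - y₀)).toNat x y le_rfl le_rfl (Int.self_le_toNat _) h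

theorem IsInterface.stabilizes_of_mem (hD : IsInterface D) {x y : ℤ} (h : (x, y) ∈ D) :
    Stabilizes D (.hor x (y + 1)) ∧ Stabilizes D (.ver (x + 1) y) := by
  obtain ⟨x₀, hx₀⟩ := hD.right y
  obtain ⟨y₀, hy₀⟩ := hD.up x
  have key : ∀ n : ℕ, ∀ x' y', x ≤ x' → y ≤ y' → (x₀ - x') + (y₀ - y') ≤ n → (x', y') ∈ D →
      Stabilizes D (.hor x' (y' + 1)) ∧ Stabilizes D (.ver (x' + 1) y') := by
    intro n
    induction n with
    | zero =>
      intro x' y' hx hy hn hD'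
      have h1 : ¬ x₀ ≤ x' := fun h' => hx₀ (hD.lower.mem_of_le hD' h' hy)
      have h2 : ¬ y₀ ≤ y' := fun h' => hy₀ (hD.lower.mem_of_le hD' hx h')
      lia
    | succ n ih =>
      intro x' y' hx hy hn hD'
      constructor
      · by_cases h2 : (x', y' + 1) ∈ D
        · obtain ⟨h3, h4⟩ := ih x' (y' + 1) hx (by lia) (by push_cast at hn; lia) h2
          exact (stabilizes_below h2 h3 h4).1
        · exact stabilizes_hor_boundary h2 (by simpa using hD')
      · by_cases h2 : (x' + 1, y') ∈ D
        · obtain ⟨h3, h4⟩ := ih (x' + 1) y' (by lia) hy (by push_cast at hn; lia) h2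
          exact (stabilizes_below h2 h3 h4).2
        · exact stabilizes_ver_boundary h2 (by simpa using hD')
  exact key ((x₀ - x) + (y₀ - y)).toNat x y le_rfl le_rfl (Int.self_le_toNat _) h

theorem IsInterface.stabilizes (hD : IsInterface D) (e : Edge ℤ) : Stabilizes D e := by
  cases e with
  | hor x y =>
    by_cases h : (x, y) ∈ D
    · exact (stabilizes_below h (hD.stabilizes_of_mem h).1 (hD.stabilizes_of_mem h).2).1
    · exact (hD.stabilizes_of_notMem h).1
  | ver x y =>
    by_cases h : (x, y) ∈ D
    · exact (stabilizes_below h (hD.stabilizes_of_mem h).1 (hD.stabilizes_of_mem h).2).2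
    · exact (hD.stabilizes_of_notMem h).2

/-- Each recomputed label depends on at most two labels. -/
theorem exists_refill_depends (D : Set (ℤ × ℤ)) (e : Edge ℤ) : ∃ d d' : Edge ℤ,
    ∀ ω c c', c d = c' d → c d' = c' d' → refill D ω c e = refill D ω c' e := by
  cases e with
  | hor x y =>
    by_cases h : (x, y) ∈ D
    · exact ⟨.hor x (y + 1), .ver (x + 1) y, fun ω c c' h1 h2 => by simp [refill, h, h1, h2]⟩
    · exact ⟨.hor x (y - 1), .ver x (y - 1), fun ω c c' h1 h2 => by simp [refill, h, h1, h2]⟩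
  | ver x y =>
    by_cases h : (x, y) ∈ D
    · exact ⟨.hor x (y + 1), .ver (x + 1) y, fun ω c c' h1 h2 => by simp [refill, h, h1, h2]⟩
    · exact ⟨.hor (x - 1) y, .ver (x - 1) y, fun ω c c' h1 h2 => by simp [refill, h, h1, h2]⟩

theorem measurable_refill {f : (Site → Bool) → Labelling ℤ} (hf : Measurable f) :
    Measurable fun ω => refill D ω (f ω) := by
  have hc : ∀ e d s, Measurable fun ω : Site → Bool => complete (f ω e) (f ω d) (ω s) :=
    fun e d s => (measurable_of_countable fun t : Bool × Bool × Bool =>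
      complete t.1 t.2.1 t.2.2).comp
        (show Measurable fun ω : Site → Bool => (f ω e, f ω d, ω s) by fun_prop)
  refine measurable_pi_iff.2 fun e => ?_
  cases e with
  | hor x y =>
    simp only [refill]
    split_ifs
    exacts [(hc _ _ _).fst, by fun_prop, (hc _ _ _).fst]
  | ver x y =>
    simp only [refill]
    split_ifs
    exacts [(hc _ _ _).snd, by fun_prop, (hc _ _ _).snd]

/-- The labels on the boundary of `D` and the coins determine the labelling. -/
theorem IsInterface.exists_fill (hD : IsInterface D) :
    ∃ F : (Site → Bool) → Labelling ℤ, Measurable F ∧ ∀ ω c, IsFilledFrom D ω c ↔ c = F ω := by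
  choose N hN using hD.stabilizes
  -- The limit of the iterated recomputation. The starting labelling `false` is arbitrary: after `N
  -- e` steps it no longer influences the label of `e`.
  let F : (Site → Bool) → Labelling ℤ := fun ω e => (refill D ω)^[N e] (fun _ => false) e
  have hit : ∀ n, Measurable fun ω => (refill D ω)^[n] (fun _ => false) := by
    intro n
    induction n with
    | zero => exact measurable_const
    | succ n ih =>
      simp only [Function.iterate_succ_apply']
      exact measurable_refill ih
  have hF : ∀ ω e, ∀ n ≥ N e, ∀ c, (refill D ω)^[n] c e = F ω e := by
    intro ω e n hn c
    obtain ⟨m, rfl⟩ := Nat.exists_eq_add_of_le hn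
    rw [Function.iterate_add_apply]
    exact hN e _ le_rfl _ _ _
  refine ⟨F, measurable_pi_iff.2 fun e => (measurable_pi_apply e).comp (hit (N e)), fun ω c => ?_⟩
  rw [isFilledFrom_iff_refill_eq hD.lower]
  constructor
  · intro h
    ext e
    rw [← hF ω e (N e) le_rfl c, Function.iterate_fixed h]
  · rintro rfl
    ext e
    obtain ⟨d, d', hdep⟩ := exists_refill_depends D e
    -- After `n` steps `e` and the two edges it depends on have all reached their final labels, so
    -- one more recomputation shows that `F ω` is fixed.
    let n := max (N e) (max (N d) (N d'))
    rw [← hF ω e (n + 1) (by lia) (fun _ => false), Function.iterate_succ_apply']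
    exact hdep _ _ _ (hF ω d n (by lia) _).symm (hF ω d' n (by lia) _).symm

/-- The labelling of the plane filled from the boundary of `D`. -/
noncomputable def IsInterface.fill (hD : IsInterface D) : (Site → Bool) → Labelling ℤ :=
  hD.exists_fill.choose

theorem IsInterface.measurable_fill (hD : IsInterface D) : Measurable hD.fill :=
  hD.exists_fill.choose_spec.1

theorem IsInterface.isFilledFrom_iff (hD : IsInterface D) {ω : Site → Bool} {c : Labelling ℤ} :
    IsFilledFrom D ω c ↔ c = hD.fill ω :=
  hD.exists_fill.choose_spec.2 ω c

theorem IsInterface.isFilledFrom_fill (hD : IsInterface D) (ω : Site → Bool) :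
    IsFilledFrom D ω (hD.fill ω) :=
  hD.isFilledFrom_iff.2 rfl

end Filling

/-! ### Moving the interface across squares. -/

section Flip

/-- Independent labels with the correct marginals on all edges and fair coins on all squares. -/
noncomputable def siteLaw (p : unitInterval) : Site → Measure Bool
  | .inl e => edgeLaw p e
  | .inr _ => fairCoin

instance (p : unitInterval) (s : Site) : IsProbabilityMeasure (siteLaw p s) := by
  cases s <;> (unfold siteLaw; infer_instance)

/-- Labels are placed on all edges, not only on one boundary, so that all interfaces share one
probability space; a filling reads only the boundary labels and the coins. -/
noncomputable def sourceLaw (p : unitInterval) : Measure (Site → Bool) :=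
  Measure.infinitePi (siteLaw p)

instance (p : unitInterval) : IsProbabilityMeasure (sourceLaw p) := by
  unfold sourceLaw; infer_instance

open scoped Classical in
/-- Exchange lower and upper edge, and left and right edge, of a square. -/
noncomputable def reflectSquare (x y : ℤ) : Equiv.Perm (Edge ℤ) :=
  Equiv.swap (.hor x y) (.hor x (y + 1)) * Equiv.swap (.ver x y) (.ver (x + 1) y)

theorem reflectSquare_upper (x y : ℤ) : reflectSquare x y (.hor x (y + 1)) = .hor x y := by
  classical
  simp [reflectSquare, Equiv.swap_apply_of_ne_of_ne]

theorem reflectSquare_right (x y : ℤ) : reflectSquare x y (.ver (x + 1) y) = .ver x y := by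
  classical
  simp [reflectSquare, Equiv.swap_apply_of_ne_of_ne]

theorem reflectSquare_of_ne {x y : ℤ} {e : Edge ℤ} (h1 : e ≠ .hor x y) (h2 : e ≠ .hor x (y + 1))
    (h3 : e ≠ .ver x y) (h4 : e ≠ .ver (x + 1) y) : reflectSquare x y e = e := by
  classical
  rw [reflectSquare, Equiv.Perm.mul_apply, Equiv.swap_apply_of_ne_of_ne h3 h4,
    Equiv.swap_apply_of_ne_of_ne h1 h2]

theorem edgeLaw_reflectSquare (p : unitInterval) (x y : ℤ) (e : Edge ℤ) :
    edgeLaw p (reflectSquare x y e) = edgeLaw p e := by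
  classical
  have hswap : ∀ a b : Edge ℤ, edgeLaw p a = edgeLaw p b →
      ∀ e, edgeLaw p (Equiv.swap a b e) = edgeLaw p e := by
    intro a b hab e
    rw [Equiv.swap_apply_def]
    split_ifs with h1 h2
    · rw [h1, hab]
    · rw [h2, hab]
    · rfl
  rw [reflectSquare, Equiv.Perm.mul_apply, hswap, hswap]
  exacts [rfl, rfl]

/-- Move the labels of the lower and left edges of a square to its upper and right edges,
completing the square. -/
noncomputable def flipSquare (x y : ℤ) (ω : Site → Bool) : Site → Bool :=
  twist (.inl (.hor x (y + 1))) (.inl (.ver (x + 1) y)) (.inr (x, y))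
    fun s => ω (Equiv.sumCongr (reflectSquare x y) (Equiv.refl _) s)

theorem measurable_flipSquare (x y : ℤ) : Measurable (flipSquare x y) :=
  measurable_twist.comp (by fun_prop)

/-- The reflection exchanges edges of the same orientation, hence of the same marginal, and the
subsequent `twist` preserves the product measure. -/
theorem sourceLaw_map_flipSquare (p : unitInterval) (x y : ℤ) :
    (sourceLaw p).map (flipSquare x y) = sourceLaw p := by
  have h := Measure.map_infinitePi_infinitePi_of_inj (P := siteLaw p)
    (Equiv.sumCongr (reflectSquare x y) (Equiv.refl (ℤ × ℤ))).injective
  have h' : (fun s => siteLaw p (Equiv.sumCongr (reflectSquare x y) (Equiv.refl (ℤ × ℤ)) s)) =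
      siteLaw p := by
    funext s
    cases s with
    | inl e => exact edgeLaw_reflectSquare p x y e
    | inr s => rfl
  rw [h'] at h
  have hf : flipSquare x y =
      twist (.inl (.hor x (y + 1))) (.inl (.ver (x + 1) y)) (.inr (x, y)) ∘
        fun (ω : Site → Bool) s => ω (Equiv.sumCongr (reflectSquare x y) (Equiv.refl _) s) := rfl
  rw [hf, ← Measure.map_map measurable_twist (by fun_prop), sourceLaw, h]
  exact infinitePi_map_twist p (by simp) (by simp) (by simp) rfl rfl rfl

theorem flipSquare_upper (x y : ℤ) (ω : Site → Bool) :
    flipSquare x y ω (.inl (.hor x (y + 1))) =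
      (complete (ω (.inl (.hor x y))) (ω (.inl (.ver x y))) (ω (.inr (x, y)))).1 := by
  rw [flipSquare, twist_fst]
  simp [reflectSquare_upper, reflectSquare_right]

theorem flipSquare_right (x y : ℤ) (ω : Site → Bool) :
    flipSquare x y ω (.inl (.ver (x + 1) y)) =
      (complete (ω (.inl (.hor x y))) (ω (.inl (.ver x y))) (ω (.inr (x, y)))).2 := by
  rw [flipSquare, twist_snd (by simp)]
  simp [reflectSquare_upper, reflectSquare_right]

theorem flipSquare_coin (x y : ℤ) (ω : Site → Bool) :
    flipSquare x y ω (.inr (x, y)) =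
      if ω (.inl (.hor x y)) = ω (.inl (.ver x y)) then ω (.inl (.hor x y))
      else ω (.inr (x, y)) := by
  rw [flipSquare, twist_coin (by simp) (by simp)]
  simp [reflectSquare_upper, reflectSquare_right]

theorem flipSquare_coin_of_ne {x y : ℤ} {s : ℤ × ℤ} (hs : s ≠ (x, y)) (ω : Site → Bool) :
    flipSquare x y ω (.inr s) = ω (.inr s) := by
  rw [flipSquare, twist_of_ne (by simp) (by simp) (by simpa using hs)]
  simp

theorem flipSquare_edge_of_ne {x y : ℤ} {e : Edge ℤ} (h1 : e ≠ .hor x y) (h2 : e ≠ .hor x (y + 1))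
    (h3 : e ≠ .ver x y) (h4 : e ≠ .ver (x + 1) y) (ω : Site → Bool) :
    flipSquare x y ω (.inl e) = ω (.inl e) := by
  rw [flipSquare, twist_of_ne (by simpa using h2) (by simpa using h4) (by simp)]
  simp [reflectSquare_of_ne h1 h2 h3 h4]

variable {D D' : Set (ℤ × ℤ)}

/-- The labelling stays the same while its source data change. The lower and left edges of the
square lie on the old boundary, as both neighbouring squares are in `D`; the upper and right edges
lie in its interior and receive the completed labels. -/
theorem IsFilledFrom.flipSquare {x y : ℤ} {ω : Site → Bool} {c : Labelling ℤ}
    (h : IsFilledFrom D ω c) (hs : (x, y) ∉ D)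
    (hD' : IsLowerSet (insert (x, y) D)) :
    IsFilledFrom (insert (x, y) D) (flipSquare x y ω) c := by
  have hleft : (x - 1, y) ∈ D := by
    have := hD'.mem_of_le (Set.mem_insert (x, y) D) (show x - 1 ≤ x by lia) le_rfl
    simpa using this
  have hdown : (x, y - 1) ∈ D := by
    have := hD'.mem_of_le (Set.mem_insert (x, y) D) le_rfl (show y - 1 ≤ y by lia)
    simpa using this
  have el := h.hor x y hdown hs
  have ev := h.ver x y hleft hs
  have ea := h.above x y hs
  refine ⟨fun x' y' h1 h2 => ?_, fun x' y' h1 h2 => ?_, fun x' y' h1 => ?_, fun x' y' h1 => ?_⟩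
  · simp only [Set.mem_insert_iff, Prod.mk.injEq, not_or] at h1 h2
    rcases h1 with ⟨rfl, h1⟩ | h1
    · obtain rfl : y' = y + 1 := by lia
      rw [flipSquare_upper, ← el, ← ev, ← ea]
    · rw [flipSquare_edge_of_ne _ _ (by simp) (by simp), h.hor x' y' h1 h2.2]
      · rintro ⟨⟩; simp at h2
      · intro he
        obtain ⟨rfl, rfl⟩ := by simpa using he
        simp [hs] at h1
  · simp only [Set.mem_insert_iff, Prod.mk.injEq, not_or] at h1 h2
    rcases h1 with ⟨h1, rfl⟩ | h1
    · obtain rfl : x' = x + 1 := by lia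
      rw [flipSquare_right, ← el, ← ev, ← ea]
    · rw [flipSquare_edge_of_ne (by simp) (by simp), h.ver x' y' h1 h2.2]
      · rintro ⟨⟩; simp at h2
      · intro he
        obtain ⟨rfl, rfl⟩ := by simpa using he
        simp [hs] at h1
  · simp only [Set.mem_insert_iff, not_or] at h1
    rw [flipSquare_coin_of_ne h1.1, h.above x' y' h1.2]
  · rcases h1 with h1 | h1
    · obtain ⟨rfl, rfl⟩ := by simpa using h1
      rw [flipSquare_coin, ← el, ← ev]
      -- The coin stored by the flip is the one with which backward completion recovers the lower
      -- and left labels.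
      have key : ∀ a b t r κ : Bool, (t, r) = complete a b κ →
          (a, b) = complete t r (if a = b then a else κ) := by decide
      exact key _ _ _ _ _ ea
    · rw [flipSquare_coin_of_ne, h.below x' y' h1]
      rintro he
      exact hs (he ▸ h1)

/-- The law of the labelling filled from the boundary of `D`. -/
noncomputable def IsInterface.law (hD : IsInterface D) (p : unitInterval) :
    Measure (Labelling ℤ) :=
  (sourceLaw p).map hD.fill

instance (hD : IsInterface D) (p : unitInterval) : IsProbabilityMeasure (hD.law p) :=
  Measure.isProbabilityMeasure_map hD.measurable_fill.aemeasurable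

/-- By uniqueness of the filling, `hD'.fill` after the flip is `hD.fill`, and the flip preserves
`sourceLaw p`. -/
theorem IsInterface.law_insert {s : ℤ × ℤ} (hD : IsInterface D) (hs : s ∉ D)
    (hD' : IsInterface (insert s D)) (p : unitInterval) : hD'.law p = hD.law p := by
  obtain ⟨x, y⟩ := s
  have h : hD'.fill ∘ flipSquare x y = hD.fill := by
    funext ω
    exact (hD'.isFilledFrom_iff.1
      ((hD.isFilledFrom_fill ω).flipSquare hs hD'.lower)).symm
  unfold IsInterface.law
  rw [← h, ← Measure.map_map hD'.measurable_fill (measurable_flipSquare x y),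
    sourceLaw_map_flipSquare]

/-- Moving the interface over finitely many squares does not change the law. -/
theorem IsInterface.law_eq_of_finite (hD : IsInterface D) (hD' : IsInterface D') (hsub : D ⊆ D')
    (hfin : (D' \ D).Finite) (p : unitInterval) : hD'.law p = hD.law p := by
  induction hn : (D' \ D).ncard generalizing D with
  | zero =>
    rw [Set.ncard_eq_zero hfin, Set.sdiff_eq_empty] at hn
    obtain rfl := hsub.antisymm hn
    rfl
  | succ n ih =>
    have hne : (D' \ D).Nonempty := by
      rw [← Set.ncard_pos hfin]; lia
    -- Adding a minimal missing square keeps the set a lower set.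
    obtain ⟨s, hs⟩ := hfin.exists_minimal hne
    have hsub' : insert s D ⊆ D' := Set.insert_subset hs.prop.1 hsub
    have hI : IsInterface (insert s D) := by
      refine ⟨fun a b hba ha => ?_, fun y => ?_, fun y => ?_, fun x => ?_, fun x => ?_⟩
      · rcases ha with rfl | ha
        · by_cases hb : b ∈ D
          · exact Or.inr hb
          · exact Or.inl (le_antisymm hba
              (hs.le_of_le ⟨hD'.lower hba hs.prop.1, hb⟩ hba))
        · exact Or.inr (hD.lower hba ha)
      · exact (hD.left y).imp fun _ h => Or.inr h
      · exact (hD'.right y).imp fun _ h h' => h (hsub' h')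
      · exact (hD.down x).imp fun _ h => Or.inr h
      · exact (hD'.up x).imp fun _ h h' => h (hsub' h')
    have hdiff : D' \ insert s D = (D' \ D) \ {s} := by
      ext t; simp; tauto
    rw [ih hI hsub' (by rw [hdiff]; exact hfin.sdiff)
      (by rw [hdiff, Set.ncard_sdiff_singleton_of_mem hs.prop]; lia), hD.law_insert hs.prop.2]

end Flip

/-! ### Existence and uniqueness of the plane extension. -/

section PlaneExtension

theorem measurable_quadrantAt (a b : ℤ) : Measurable (quadrantAt a b) := by
  refine measurable_pi_iff.2 fun e => ?_
  cases e <;> simp only [quadrantAt] <;> fun_prop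

instance (p : unitInterval) : IsProbabilityMeasure (quadrantLaw p) :=
  Measure.isProbabilityMeasure_map measurable_quadrantFill.aemeasurable

/-- Finitely many edges lie in a common quadrant. -/
theorem exists_quadrant_of_finset (s : Finset (Edge ℤ)) :
    ∃ a b : ℤ, ∀ e ∈ s, ∃ e' : Edge ℕ, ∀ c : Labelling ℤ, quadrantAt a b c e' = c e := by
  have key : ∀ e : Edge ℤ, ∃ N : ℤ, ∀ a ≤ N, ∃ e' : Edge ℕ, ∀ c, quadrantAt a a c e' = c e := by
    intro e
    cases e with
    | hor x y =>
      refine ⟨min x y, fun a ha => ⟨.hor (x - a).toNat (y - a).toNat, fun c => ?_⟩⟩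
      simp only [quadrantAt]
      congr 2 <;> lia
    | ver x y =>
      refine ⟨min x y, fun a ha => ⟨.ver (x - a).toNat (y - a).toNat, fun c => ?_⟩⟩
      simp only [quadrantAt]
      congr 2 <;> lia
  choose N hN using key
  obtain ⟨a, ha⟩ := (s.finite_toSet.image N).bddBelow
  exact ⟨a, a, fun e he => hN e a (ha ⟨e, he, rfl⟩)⟩

/-- `IsPlaneExtension` presupposes no finiteness; the total mass is read off from one marginal. -/
theorem IsPlaneExtension.isProbabilityMeasure {p : unitInterval} {μ : Measure (Labelling ℤ)}
    (hμ : IsPlaneExtension p μ) : IsProbabilityMeasure μ := by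
  have h := hμ 0 0
  constructor
  have h' := congrArg (fun m => m Set.univ) h
  simpa [Measure.map_apply (measurable_quadrantAt 0 0) MeasurableSet.univ] using h'

theorem IsPlaneExtension.unique {p : unitInterval} {μ ν : Measure (Labelling ℤ)}
    (hμ : IsPlaneExtension p μ) (hν : IsPlaneExtension p ν) : μ = ν := by
  have := hν.isProbabilityMeasure
  refine ext_of_map_restrict fun s => ?_
  obtain ⟨a, b, h⟩ := exists_quadrant_of_finset s
  choose g hg using h
  have hr : (s.restrict : Labelling ℤ → s → Bool) =
      (fun (c : Labelling ℕ) (e : s) => c (g e.1 e.2)) ∘ quadrantAt a b := by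
    funext c e
    exact (hg e.1 e.2 c).symm
  rw [hr, ← Measure.map_map (by fun_prop) (measurable_quadrantAt a b),
    ← Measure.map_map (by fun_prop) (measurable_quadrantAt a b), hμ a b, hν a b]

variable {D : Set (ℤ × ℤ)}

/-- The labels on the axes of a quadrant and the coins of its squares. -/
def quadrantSource (a b : ℤ) (ω : Site → Bool) : (ℕ → Bool) × (ℕ → Bool) × (ℕ × ℕ → Bool) :=
  (fun n => ω (.inl (.hor (a + n) b)), fun m => ω (.inl (.ver a (b + m))),
    fun s => ω (.inr (a + s.1, b + s.2)))

theorem measurable_quadrantSource (a b : ℤ) : Measurable (quadrantSource a b) := by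
  unfold quadrantSource
  fun_prop

theorem sourceLaw_map_quadrantSource (p : unitInterval) (a b : ℤ) :
    (sourceLaw p).map (quadrantSource a b) =
      (Measure.infinitePi fun _ : ℕ => labelLaw p).prod
        ((Measure.infinitePi fun _ : ℕ => labelLaw (unitInterval.symm p)).prod
          (Measure.infinitePi fun _ : ℕ × ℕ => fairCoin)) := by
  let f : ℕ → Site := fun n => .inl (.hor (a + n) b)
  let g : ℕ → Site := fun m => .inl (.ver a (b + m))
  let k : ℕ × ℕ → Site := fun s => .inr (a + s.1, b + s.2)
  have hgk : Function.Injective (Sum.elim g k) := by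
    rintro (m | ⟨n, m⟩) (m' | ⟨n', m'⟩) h <;> simp_all [g, k]
  have hf : Function.Injective (Sum.elim f (Sum.elim g k)) := by
    rintro (n | m | ⟨n, m⟩) (n' | m' | ⟨n', m'⟩) h <;> simp_all [f, g, k]
  have h1 := infinitePi_map_prodMk (P := siteLaw p) hf
  have h2 := infinitePi_map_prodMk (P := fun t : ℕ ⊕ (ℕ × ℕ) => siteLaw p (Sum.elim g k t))
    (f := Sum.inl) (g := Sum.inr) (by
      have : (Sum.elim Sum.inl Sum.inr : ℕ ⊕ (ℕ × ℕ) → _) = id := Sum.elim_inl_inr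
      rw [this]; exact Function.injective_id)
  have h3 := congrArg (Measure.map (Prod.map id fun v : ℕ ⊕ (ℕ × ℕ) → Bool =>
    ((fun j => v (.inl j), fun t => v (.inr t)) : (ℕ → Bool) × (ℕ × ℕ → Bool)))) h1
  rw [Measure.map_map (by fun_prop) (by fun_prop),
    ← Measure.map_prod_map _ _ measurable_id (by fun_prop), h2, Measure.map_id] at h3
  exact h3

/-- In a box whose left and lower sides lie on the boundary of `D`, the labelling filled from this
boundary is that of the quadrant. -/
theorem IsFilledFrom.quadrantAt_eq {ω : Site → Bool} {c : Labelling ℤ} (h : IsFilledFrom D ω c)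
    {a b : ℤ} {n : ℕ} (hbox : ∀ x y : ℕ, x < n → y < n → (a + x, b + y) ∉ D)
    (hleft : ∀ y : ℕ, y < n → (a - 1, b + y) ∈ D) (hdown : ∀ x : ℕ, x < n → (a + x, b - 1) ∈ D)
    (x y : ℕ) (hx : x < n) (hy : y < n) :
    quadrantAt a b c (.hor x y) = quadrantFill (quadrantSource a b ω) (.hor x y) ∧
    quadrantAt a b c (.ver x y) = quadrantFill (quadrantSource a b ω) (.ver x y) := by
  have hver : ∀ y < n, (∀ x < n, c (.hor (a + x) (b + y)) =
      quadrantFill (quadrantSource a b ω) (.hor x y)) → ∀ x < n, c (.ver (a + x) (b + y)) =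
      quadrantFill (quadrantSource a b ω) (.ver x y) := by
    intro y hy hrow x
    induction x with
    | zero =>
      intro hx
      have := h.ver (a + (0 : ℕ)) (b + y) (by simpa using hleft y hy) (hbox 0 y hx hy)
      rw [this]
      simp [quadrantFill, stripVertical, quadrantSource]
    | succ x ih =>
      intro hx
      have h1 := h.above (a + x) (b + y) (hbox x y (by lia) hy)
      rw [hrow x (by lia), ih (by lia)] at h1
      have h2 := congrArg Prod.snd h1
      simp only [Nat.cast_add, Nat.cast_one, ← add_assoc]
      exact h2
  have hhor : ∀ y < n, ∀ x < n, c (.hor (a + x) (b + y)) =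
      quadrantFill (quadrantSource a b ω) (.hor x y) := by
    intro y
    induction y with
    | zero =>
      intro hy x hx
      have := h.hor (a + x) (b + (0 : ℕ)) (by simpa using hdown x hx) (hbox x 0 hx hy)
      rw [this]
      simp [quadrantFill, rowLabels, quadrantSource]
    | succ y ih =>
      intro hy x hx
      have h1 := h.above (a + x) (b + y) (hbox x y hx (by lia))
      rw [ih (by lia) x hx, hver y (by lia) (ih (by lia)) x hx] at h1
      have h2 := congrArg Prod.fst h1
      simp only [Nat.cast_add, Nat.cast_one, ← add_assoc]
      exact h2
  exact ⟨hhor y hy x hx, hver y hy (hhor y hy) x hx⟩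

/-- Finitely many edges of the first quadrant lie in a common box. -/
theorem exists_box_of_finset (s : Finset (Edge ℕ)) :
    ∃ n : ℕ, ∀ e ∈ s, ∃ x y, x < n ∧ y < n ∧ (e = .hor x y ∨ e = .ver x y) := by
  have key : ∀ e : Edge ℕ, ∃ N : ℕ, ∀ n ≥ N, ∃ x y, x < n ∧ y < n ∧ (e = .hor x y ∨ e = .ver x y)
    | .hor x y => ⟨max x y + 1, fun n hn => ⟨x, y, by lia, by lia, .inl rfl⟩⟩
    | .ver x y => ⟨max x y + 1, fun n hn => ⟨x, y, by lia, by lia, .inr rfl⟩⟩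
  choose N hN using key
  obtain ⟨n, hn⟩ := (s.finite_toSet.image N).bddAbove
  exact ⟨n, fun e he => hN e n (hn ⟨e, he, rfl⟩)⟩

/-- By finitely many flips an interface can be moved to the left and lower sides of a box. -/
theorem IsInterface.exists_box (hD : IsInterface D) (p : unitInterval) (a b : ℤ) (n : ℕ) :
    ∃ (D' : Set (ℤ × ℤ)) (hD' : IsInterface D'), hD'.law p = hD.law p ∧
      (∀ x y : ℕ, x < n → y < n → (a + x, b + y) ∉ D') ∧
      (∀ y : ℕ, y < n → (a - 1, b + y) ∈ D') ∧ (∀ x : ℕ, x < n → (a + x, b - 1) ∈ D') := by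
  -- Removing `U` from `D` clears the box; adding `L` then puts its left and lower neighbours below
  -- the interface. Since `D` is a lower set bounded in row `b` and column `a`, the first move
  -- involves finitely many squares; the second does because `D \ U` meets row `b + n` and column `a
  -- + n`.
  let U : Set (ℤ × ℤ) := {s | a ≤ s.1 ∧ b ≤ s.2}
  let L : Set (ℤ × ℤ) := {s | s.1 < a ∧ s.2 < b + n ∨ s.1 < a + n ∧ s.2 < b}
  have hU : ∀ x y, (x, y) ∈ U ↔ a ≤ x ∧ b ≤ y := fun _ _ => Iff.rfl
  have hL : ∀ x y, (x, y) ∈ L ↔ x < a ∧ y < b + n ∨ x < a + n ∧ y < b := fun _ _ => Iff.rfl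
  have h1 : IsInterface (D \ U) := by
    refine ⟨?_, fun y => ?_, fun y => ?_, fun x => ?_, fun x => ?_⟩
    · rintro ⟨x, y⟩ ⟨x', y'⟩ ⟨hx, hy⟩ ⟨h, h'⟩
      refine ⟨hD.lower.mem_of_le h hx hy, fun h'' => h' ?_⟩
      simp only [hU] at h'' ⊢
      simp only at hx hy
      lia
    · obtain ⟨x, hx⟩ := hD.left y
      exact ⟨min x (a - 1), hD.lower.mem_of_le hx (by lia) le_rfl, by rw [hU]; lia⟩
    · exact (hD.right y).imp fun _ h h' => h h'.1
    · obtain ⟨y, hy⟩ := hD.down x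
      exact ⟨min y (b - 1), hD.lower.mem_of_le hy le_rfl (by lia), by rw [hU]; lia⟩
    · exact (hD.up x).imp fun _ h h' => h h'.1
  have h2 : IsInterface (D \ U ∪ L) := by
    refine ⟨?_, fun y => ?_, fun y => ?_, fun x => ?_, fun x => ?_⟩
    · refine h1.lower.union ?_
      rintro ⟨x, y⟩ ⟨x', y'⟩ ⟨hx, hy⟩ h
      simp only [hL] at h ⊢
      simp only at hx hy
      lia
    · exact (h1.left y).imp fun _ h => Or.inl h
    · obtain ⟨x, hx⟩ := h1.right y
      refine ⟨max x (a + n), ?_⟩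
      rintro (h | h)
      · exact hx (h1.lower.mem_of_le h (by lia) le_rfl)
      · rw [hL] at h; lia
    · exact (h1.down x).imp fun _ h => Or.inl h
    · obtain ⟨y, hy⟩ := h1.up x
      refine ⟨max y (b + n), ?_⟩
      rintro (h | h)
      · exact hy (h1.lower.mem_of_le h le_rfl (by lia))
      · rw [hL] at h; lia
  have hfin1 : (D \ (D \ U)).Finite := by
    obtain ⟨x₀, hx₀⟩ := hD.right b
    obtain ⟨y₀, hy₀⟩ := hD.up a
    refine (Set.finite_Icc ((a, b) : ℤ × ℤ) (x₀, y₀)).subset ?_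
    rintro ⟨x, y⟩ ⟨h, h'⟩
    have hxy : (x, y) ∈ U := by by_contra h''; exact h' ⟨h, h''⟩
    rw [hU] at hxy
    refine ⟨⟨hxy.1, hxy.2⟩, ⟨?_, ?_⟩⟩
    · by_contra hlt
      exact hx₀ (hD.lower.mem_of_le h (by simp only at hlt; lia) hxy.2)
    · by_contra hlt
      exact hy₀ (hD.lower.mem_of_le h hxy.1 (by simp only at hlt; lia))
  have hfin2 : ((D \ U ∪ L) \ (D \ U)).Finite := by
    obtain ⟨x₀, hx₀⟩ := h1.left (b + n)
    obtain ⟨y₀, hy₀⟩ := h1.down (a + n)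
    refine (Set.finite_Icc ((x₀, y₀) : ℤ × ℤ) (a + n, b + n)).subset ?_
    rintro ⟨x, y⟩ ⟨h | h, h'⟩
    · exact absurd h h'
    rw [hL] at h
    have hx : x ≤ a + n := by lia
    have hy : y ≤ b + n := by lia
    refine ⟨⟨?_, ?_⟩, ⟨hx, hy⟩⟩
    · by_contra hlt
      exact h' (h1.lower.mem_of_le hx₀ (by simp only at hlt; lia) hy)
    · by_contra hlt
      exact h' (h1.lower.mem_of_le hy₀ hx (by simp only at hlt; lia))
  refine ⟨_, h2, ?_, fun x y hx hy => ?_, fun y hy => ?_, fun x hx => ?_⟩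
  · rw [h1.law_eq_of_finite h2 Set.subset_union_left hfin2,
      ← h1.law_eq_of_finite hD Set.sdiff_subset hfin1]
  · rintro (h | h)
    · exact h.2 (by rw [hU]; lia)
    · rw [hL] at h; lia
  · exact Or.inr (by rw [hL]; lia)
  · exact Or.inr (by rw [hL]; lia)

/-- A finite-dimensional marginal of a quadrant sees only a box. Moving the interface to the sides
of this box keeps the law, and there the filling is literally the quadrant procedure run with
independent labels and coins. -/
theorem IsInterface.isPlaneExtension_law (hD : IsInterface D) (p : unitInterval) :
    IsPlaneExtension p (hD.law p) := by
  intro a b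
  refine ext_of_map_restrict fun s => ?_
  obtain ⟨n, hn⟩ := exists_box_of_finset s
  obtain ⟨D', hD', hlaw, hbox, hleft, hdown⟩ := hD.exists_box p a b n
  have hcomp : s.restrict ∘ quadrantAt a b ∘ hD'.fill =
      s.restrict ∘ quadrantFill ∘ quadrantSource a b := by
    funext ω ⟨e, he⟩
    obtain ⟨x, y, hx, hy, hxy⟩ := hn e he
    have h := (hD'.isFilledFrom_fill ω).quadrantAt_eq hbox hleft hdown x y hx hy
    rcases hxy with rfl | rfl
    exacts [h.1, h.2]
  have hr : Measurable (s.restrict : Labelling ℕ → s → Bool) := by fun_prop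
  rw [← hlaw, IsInterface.law, Measure.map_map (measurable_quadrantAt a b) hD'.measurable_fill,
    Measure.map_map hr ((measurable_quadrantAt a b).comp hD'.measurable_fill), hcomp,
    quadrantLaw, ← sourceLaw_map_quadrantSource p a b,
    Measure.map_map measurable_quadrantFill (measurable_quadrantSource a b),
    Measure.map_map hr (measurable_quadrantFill.comp (measurable_quadrantSource a b))]

/-- An arbitrary choice of interface that gives existence. -/
theorem isInterface_staircase : IsInterface {s : ℤ × ℤ | s.1 + s.2 < 0} := by
  refine ⟨?_, fun y => ⟨-y - 1, ?_⟩, fun y => ⟨-y, ?_⟩, fun x => ⟨-x - 1, ?_⟩, fun x => ⟨-x, ?_⟩⟩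
  · rintro ⟨x, y⟩ ⟨x', y'⟩ ⟨hx, hy⟩ h
    simp only [Set.mem_ofPred_eq] at hx hy h ⊢
    lia
  all_goals simp only [Set.mem_ofPred_eq]; lia

theorem existsUnique_isPlaneExtension (p : unitInterval) :
    ∃! μ : Measure (Labelling ℤ), IsPlaneExtension p μ :=
  ⟨_, isInterface_staircase.isPlaneExtension_law p, fun _ hμ =>
    hμ.unique (isInterface_staircase.isPlaneExtension_law p)⟩

end PlaneExtension

/-! ### Directed paths and independence along them. -/

section Path

variable {z : ℤ → ℤ × ℤ} {D : Set (ℤ × ℤ)}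

theorem IsDirectedPath.step (hz : IsDirectedPath z) (i : ℤ) :
    (z (i + 1) = ((z i).1 + 1, (z i).2) ∧ pathEdge z i = .hor (z i).1 (z i).2) ∨
    (z (i + 1) = ((z i).1, (z i).2 - 1) ∧ pathEdge z i = .ver (z i).1 ((z i).2 - 1)) := by
  have h1 := hz.adjacent i
  have h2 : (z i).1 ≤ (z (i + 1)).1 := hz.fst_monotone (by lia)
  have h3 : (z (i + 1)).2 ≤ (z i).2 := hz.snd_antitone (by lia)
  rw [abs_of_nonneg (by lia), abs_of_nonpos (by lia)] at h1
  by_cases h : (z i).2 = (z (i + 1)).2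
  · left
    have h4 : (z (i + 1)).1 = (z i).1 + 1 := by lia
    refine ⟨Prod.ext h4 h.symm, ?_⟩
    rw [pathEdge, edgeBetween, if_pos h, min_eq_left h2]
  · right
    have h4 : (z (i + 1)).2 = (z i).2 - 1 := by lia
    refine ⟨Prod.ext (by simp only; lia) h4, ?_⟩
    rw [pathEdge, edgeBetween, if_neg h, min_eq_right h3, h4]

/-- Both kinds of step raise the difference of the coordinates by one, so a vertex determines its
index; this yields injectivity of `pathEdge`. -/
theorem IsDirectedPath.fst_sub_snd (hz : IsDirectedPath z) (i : ℤ) :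
    (z i).1 - (z i).2 = (z 0).1 - (z 0).2 + i := by
  have hstep : ∀ i, (z (i + 1)).1 - (z (i + 1)).2 = (z i).1 - (z i).2 + 1 := by
    intro i
    rcases hz.step i with ⟨h, -⟩ | ⟨h, -⟩ <;> rw [h] <;> ring
  induction i with
  | zero => simp
  | succ i ih => rw [hstep, ih]; ring
  | pred i ih =>
    have := hstep (-i - 1)
    rw [sub_add_cancel] at this
    lia

theorem IsDirectedPath.pathEdge_injective (hz : IsDirectedPath z) :
    Function.Injective (pathEdge z) := by
  intro i j hij
  have hi := hz.fst_sub_snd i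
  have hj := hz.fst_sub_snd j
  rcases hz.step i with ⟨-, h⟩ | ⟨-, h⟩ <;> rcases hz.step j with ⟨-, h'⟩ | ⟨-, h'⟩ <;>
    rw [h, h'] at hij
  · rw [Edge.hor.injEq] at hij; lia
  · cases hij
  · cases hij
  · rw [Edge.ver.injEq] at hij; lia

/-- No square is both above and below a directed path. -/
theorem IsDirectedPath.not_above_and_below (hz : IsDirectedPath z) {x y i j : ℤ}
    (h1 : (z i).1 ≤ x) (h2 : (z i).2 ≤ y) (h3 : x + 1 ≤ (z j).1) (h4 : y + 1 ≤ (z j).2) :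
    False := by
  rcases le_total i j with h | h
  · have := hz.snd_antitone h
    simp only at this
    lia
  · have := hz.fst_monotone h
    simp only at this
    lia

/-- If two consecutive vertices of the path separate `D` from its complement, then the edge between
them keeps its label. -/
theorem IsFilledFrom.apply_pathEdge {ω : Site → Bool} {c : Labelling ℤ} (h : IsFilledFrom D ω c)
    (hz : IsDirectedPath z) (i : ℤ)
    (hU : ∀ j, i ≤ j → j ≤ i + 1 → ∀ x y, (z j).1 ≤ x → (z j).2 ≤ y → (x, y) ∉ D)
    (hL : ∀ j, i ≤ j → j ≤ i + 1 → ∀ x y, x + 1 ≤ (z j).1 → y + 1 ≤ (z j).2 → (x, y) ∈ D) :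
    c (pathEdge z i) = ω (.inl (pathEdge z i)) := by
  rcases hz.step i with ⟨h1, h2⟩ | ⟨h1, h2⟩ <;> rw [h2]
  · exact h.hor _ _ (hL (i + 1) (by lia) le_rfl _ _ (by rw [h1]) (by rw [h1]; lia))
      (hU i le_rfl (by lia) _ _ le_rfl le_rfl)
  · exact h.ver _ _ (hL i le_rfl (by lia) _ _ (by lia) (by lia))
      (hU (i + 1) (by lia) le_rfl _ _ (by rw [h1]) (by rw [h1]))

/-- A finite piece of a directed path is part of the boundary of an interface. -/
theorem IsDirectedPath.exists_interface (hz : IsDirectedPath z) (N : ℕ) :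
    ∃ D : Set (ℤ × ℤ), IsInterface D ∧ ∀ j, -(N : ℤ) ≤ j → j ≤ N →
      (∀ x y, (z j).1 ≤ x → (z j).2 ≤ y → (x, y) ∉ D) ∧
      (∀ x y, x + 1 ≤ (z j).1 → y + 1 ≤ (z j).2 → (x, y) ∈ D) := by
  -- The staircase `x + y < 0`, modified to contain all squares below the finite piece and none
  -- above it. The staircase keeps every row and column non-trivial far from the piece.
  let D : Set (ℤ × ℤ) := {s |
    (s.1 + s.2 < 0 ∨ ∃ j, -(N : ℤ) ≤ j ∧ j ≤ N ∧ s.1 + 1 ≤ (z j).1 ∧ s.2 + 1 ≤ (z j).2) ∧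
    ¬ ∃ j, -(N : ℤ) ≤ j ∧ j ≤ N ∧ (z j).1 ≤ s.1 ∧ (z j).2 ≤ s.2}
  have hmem : ∀ x y, (x, y) ∈ D ↔
    (x + y < 0 ∨ ∃ j, -(N : ℤ) ≤ j ∧ j ≤ N ∧ x + 1 ≤ (z j).1 ∧ y + 1 ≤ (z j).2) ∧
    ¬ ∃ j, -(N : ℤ) ≤ j ∧ j ≤ N ∧ (z j).1 ≤ x ∧ (z j).2 ≤ y := fun _ _ => Iff.rfl
  have hfst : ∀ j, -(N : ℤ) ≤ j → j ≤ N → (z (-N)).1 ≤ (z j).1 ∧ (z j).1 ≤ (z N).1 :=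
    fun j h1 h2 => ⟨hz.fst_monotone h1, hz.fst_monotone h2⟩
  have hsnd : ∀ j, -(N : ℤ) ≤ j → j ≤ N → (z N).2 ≤ (z j).2 ∧ (z j).2 ≤ (z (-N)).2 :=
    fun j h1 h2 => ⟨hz.snd_antitone h2, hz.snd_antitone h1⟩
  refine ⟨D, ⟨?_, fun y => ?_, fun y => ?_, fun x => ?_, fun x => ?_⟩, fun j h1 h2 =>
    ⟨fun x y h3 h4 h => ?_, fun x y h3 h4 => ?_⟩⟩
  · rintro ⟨x, y⟩ ⟨x', y'⟩ ⟨hx, hy⟩ h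
    simp only at hx hy
    rw [hmem] at h ⊢
    refine ⟨h.1.imp (fun h => by lia) ?_, fun ⟨j, h1, h2, h3, h4⟩ =>
      h.2 ⟨j, h1, h2, by lia, by lia⟩⟩
    rintro ⟨j, h1, h2, h3, h4⟩
    exact ⟨j, h1, h2, by lia, by lia⟩
  · refine ⟨min (-y - 1) ((z (-N)).1 - 1), (hmem _ _).2 ⟨.inl (by lia), ?_⟩⟩
    rintro ⟨j, h1, h2, h3, h4⟩
    have := hfst j h1 h2
    lia
  · refine ⟨max (-y) (z N).1, fun h => ?_⟩
    rcases ((hmem _ _).1 h).1 with h | ⟨j, h1, h2, h3, h4⟩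
    · lia
    · have := hfst j h1 h2
      lia
  · refine ⟨min (-x - 1) ((z N).2 - 1), (hmem _ _).2 ⟨.inl (by lia), ?_⟩⟩
    rintro ⟨j, h1, h2, h3, h4⟩
    have := hsnd j h1 h2
    lia
  · refine ⟨max (-x) (z (-N)).2, fun h => ?_⟩
    rcases ((hmem _ _).1 h).1 with h | ⟨j, h1, h2, h3, h4⟩
    · lia
    · have := hsnd j h1 h2
      lia
  · exact ((hmem _ _).1 h).2 ⟨j, h1, h2, h3, h4⟩
  · refine (hmem _ _).2 ⟨.inr ⟨j, h1, h2, h3, h4⟩, ?_⟩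
    rintro ⟨k, -, -, h5, h6⟩
    exact hz.not_above_and_below h5 h6 h3 h4

/-- The labels along a directed path are independent. -/
theorem IsPlaneExtension.iIndepFun_pathEdge {p : unitInterval} {μ : Measure (Labelling ℤ)}
    (hμ : IsPlaneExtension p μ) (hz : IsDirectedPath z) :
    iIndepFun (fun (i : ℤ) (c : Labelling ℤ) => c (pathEdge z i)) μ := by
  have hind : iIndepFun (fun (i : ℤ) (ω : Site → Bool) => ω (.inl (pathEdge z i)))
      (sourceLaw p) :=
    (iIndepFun_infinitePi (P := siteLaw p) (X := fun _ b => b) fun _ => measurable_id).precomp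
      (g := fun i => .inl (pathEdge z i)) (Sum.inl_injective.comp hz.pathEdge_injective)
  rw [iIndepFun_iff_measure_inter_preimage_eq_mul] at hind ⊢
  intro S A hA
  -- The bound is on `i + 1` because the edge with index `i` ends at the vertex `z (i + 1)`.
  obtain ⟨N, hN⟩ : ∃ N : ℕ, ∀ i ∈ S, -(N : ℤ) ≤ i ∧ i + 1 ≤ N := by
    obtain ⟨N, hN⟩ := (S.finite_toSet.image fun i : ℤ => i.natAbs + 1).bddAbove
    refine ⟨N, fun i hi => ?_⟩
    have := hN ⟨i, hi, rfl⟩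
    simp only at this
    lia
  obtain ⟨D, hD, hsep⟩ := hz.exists_interface N
  -- The interface depends on `S`, but by uniqueness its law is always `μ`.
  obtain rfl := hμ.unique (hD.isPlaneExtension_law p)
  have hlabel : ∀ i ∈ S, ∀ ω, hD.fill ω (pathEdge z i) = ω (.inl (pathEdge z i)) := by
    intro i hi ω
    have hi' := hN i hi
    exact (hD.isFilledFrom_fill ω).apply_pathEdge hz i
      (fun j h1 h2 => (hsep j (by lia) (by lia)).1) fun j h1 h2 => (hsep j (by lia) (by lia)).2
  have hpre : ∀ i ∈ S, hD.fill ⁻¹' ((fun c : Labelling ℤ => c (pathEdge z i)) ⁻¹' A i) =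
      (fun ω : Site → Bool => ω (.inl (pathEdge z i))) ⁻¹' A i := by
    intro i hi
    ext ω
    simp only [Set.mem_preimage, hlabel i hi ω]
  have hmeas : ∀ i ∈ S, MeasurableSet ((fun c : Labelling ℤ => c (pathEdge z i)) ⁻¹' A i) :=
    fun i hi => measurable_pi_apply _ (hA i hi)
  rw [IsInterface.law, Measure.map_apply hD.measurable_fill (S.measurableSet_biInter hmeas),
    Set.preimage_iInter₂, Set.iInter₂_congr hpre, hind S hA]
  refine Finset.prod_congr rfl fun i hi => ?_
  rw [Measure.map_apply hD.measurable_fill (hmeas i hi), hpre i hi]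

/-! ### Filling from a path unbounded in all four directions. -/

section Unbounded

/-- The squares below a path. -/
def belowPath (z : ℤ → ℤ × ℤ) : Set (ℤ × ℤ) := {s | SquareBelow z s.1 s.2}

theorem IsUnboundedPath.exists_hor_step (hu : IsUnboundedPath z) (hz : IsDirectedPath z) (x : ℤ) :
    ∃ i, (z i).1 = x ∧ (z (i + 1)).1 = x + 1 ∧ (z (i + 1)).2 = (z i).2 ∧
      pathEdge z i = .hor x (z i).2 := by
  obtain ⟨b, hb⟩ := hu.left x
  -- The path crosses column `x` in the step that ends at the first vertex with abscissa at least `x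
  -- + 1`; unboundedness to the left bounds such indices below.
  obtain ⟨k, hk, hmin⟩ := Int.exists_least_of_bdd (P := fun i => x + 1 ≤ (z i).1)
    ⟨b, fun i hi => by
      by_contra hlt
      have : (z i).1 ≤ (z b).1 := hz.fst_monotone (by lia)
      lia⟩ (hu.right (x + 1))
  have h1 : ¬ x + 1 ≤ (z (k - 1)).1 := fun h => by have := hmin _ h; lia
  refine ⟨k - 1, ?_⟩
  have hs := hz.step (k - 1)
  rw [sub_add_cancel] at hs ⊢
  rcases hs with ⟨h, h'⟩ | ⟨h, h'⟩
  · rw [h] at hk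
    have h2 : (z (k - 1)).1 = x := by simp only at hk; lia
    rw [h, h', h2]
    simp
  · rw [h] at hk
    exact absurd hk h1

theorem IsUnboundedPath.exists_ver_step (hu : IsUnboundedPath z) (hz : IsDirectedPath z) (y : ℤ) :
    ∃ i, (z i).2 = y + 1 ∧ (z (i + 1)).2 = y ∧ (z (i + 1)).1 = (z i).1 ∧
      pathEdge z i = .ver (z i).1 y := by
  obtain ⟨b, hb⟩ := hu.down y
  obtain ⟨k, hk, hmax⟩ := Int.exists_greatest_of_bdd (P := fun i => y + 1 ≤ (z i).2)
    ⟨b, fun i hi => by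
      by_contra hlt
      have : (z i).2 ≤ (z b).2 := hz.snd_antitone (by lia)
      lia⟩ (hu.up (y + 1))
  have h1 : ¬ y + 1 ≤ (z (k + 1)).2 := fun h => by have := hmax _ h; lia
  refine ⟨k, ?_⟩
  rcases hz.step k with ⟨h, h'⟩ | ⟨h, h'⟩
  · rw [h] at h1
    exact absurd hk h1
  · rw [h] at h1
    have h2 : (z k).2 = y + 1 := by simp only at h1; lia
    rw [h, h', h2]
    simp

/-- Each square is either above or below an unbounded directed path. -/
theorem IsUnboundedPath.squareAbove_iff (hu : IsUnboundedPath z) (hz : IsDirectedPath z)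
    {x y : ℤ} : SquareAbove z x y ↔ ¬ SquareBelow z x y := by
  constructor
  · rintro ⟨i, h1, h2⟩ ⟨j, h3, h4⟩
    exact hz.not_above_and_below h1 h2 h3 h4
  · intro h
    -- The height of the horizontal step in column `x` decides on which side of the path a square of
    -- this column lies.
    obtain ⟨i, h1, h2, h3, -⟩ := hu.exists_hor_step hz x
    refine ⟨i, h1.le, ?_⟩
    by_contra h4
    exact h ⟨i + 1, h2.ge, by lia⟩

theorem IsUnboundedPath.isInterface_belowPath (hu : IsUnboundedPath z) (hz : IsDirectedPath z) :
    IsInterface (belowPath z) := by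
  refine ⟨?_, fun y => ?_, fun y => ?_, fun x => ?_, fun x => ?_⟩
  · rintro ⟨x, y⟩ ⟨x', y'⟩ ⟨hx, hy⟩ ⟨i, h1, h2⟩
    simp only at hx hy h1 h2
    exact ⟨i, by simp only; lia, by simp only; lia⟩
  · obtain ⟨i, hi⟩ := hu.up (y + 1)
    exact ⟨(z i).1 - 1, i, by simp, hi⟩
  · obtain ⟨i, hi⟩ := hu.down y
    exact ⟨(z i).1, (hu.squareAbove_iff hz).1 ⟨i, le_rfl, hi⟩⟩
  · obtain ⟨i, hi⟩ := hu.right (x + 1)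
    exact ⟨(z i).2 - 1, i, hi, by simp⟩
  · obtain ⟨i, hi⟩ := hu.left x
    exact ⟨(z i).2, (hu.squareAbove_iff hz).1 ⟨i, hi, le_rfl⟩⟩

/-- Filling the plane from an unbounded path means filling it from the boundary of the set of
squares below the path. -/
theorem IsUnboundedPath.isFilling_iff (hu : IsUnboundedPath z) (hz : IsDirectedPath z)
    {ω : Site → Bool} {c : Labelling ℤ} :
    IsFilling z (fun i => ω (.inl (pathEdge z i))) (fun s => ω (.inr s)) c ↔
      IsFilledFrom (belowPath z) ω c := by
  constructor
  · intro h
    refine ⟨fun x y h1 h2 => ?_, fun x y h1 h2 => ?_, fun x y h1 => ?_, fun x y h1 => ?_⟩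
    · obtain ⟨i, e1, e2, e3, e4⟩ := hu.exists_hor_step hz x
      have h3 : ¬ (z i).2 ≤ y - 1 := fun h' => (hu.squareAbove_iff hz).1 ⟨i, e1.le, h'⟩ h1
      have h4 : ¬ y + 1 ≤ (z i).2 := fun h' => h2 ⟨i + 1, e2.ge, by simp only; lia⟩
      obtain rfl : y = (z i).2 := by lia
      rw [← e4]
      exact h.on_path i
    · obtain ⟨i, e1, e2, e3, e4⟩ := hu.exists_ver_step hz y
      have h3 : ¬ (z i).1 ≤ x - 1 := fun h' =>
        (hu.squareAbove_iff hz).1 ⟨i + 1, by lia, e2.le⟩ h1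
      have h4 : ¬ x + 1 ≤ (z i).1 := fun h' => h2 ⟨i, h', e1.ge⟩
      obtain rfl : x = (z i).1 := by lia
      rw [← e4]
      exact h.on_path i
    · exact h.above x y ((hu.squareAbove_iff hz).2 h1)
    · exact h.below x y h1
  · intro h
    refine ⟨fun i => ?_, fun x y h1 => ?_, fun x y h1 => ?_⟩
    · exact h.apply_pathEdge hz i
        (fun j _ _ x y h1 h2 => (hu.squareAbove_iff hz).1 ⟨j, h1, h2⟩)
        fun j _ _ x y h1 h2 => ⟨j, h1, h2⟩
    · exact h.above x y ((hu.squareAbove_iff hz).1 h1)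
    · exact h.below x y h1

theorem sourceLaw_map_pathSource (p : unitInterval) (hz : IsDirectedPath z) :
    (sourceLaw p).map (fun ω => (fun i => ω (.inl (pathEdge z i)), fun s => ω (.inr s))) =
      pathSourceLaw p z := by
  refine infinitePi_map_prodMk (P := siteLaw p) (f := fun i => .inl (pathEdge z i))
    (g := Sum.inr) ?_
  rintro (i | s) (j | t) h
  · simpa [hz.pathEdge_injective.eq_iff] using h
  · simp at h
  · simp at h
  · simpa using h

/-- The measure is the law of the labelling filled from independent labels on the path. -/
theorem IsPlaneExtension.exists_fill_path {p : unitInterval} {μ : Measure (Labelling ℤ)}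
    (hμ : IsPlaneExtension p μ) (hz : IsDirectedPath z) (hu : IsUnboundedPath z) :
    ∃ F : (ℤ → Bool) × (ℤ × ℤ → Bool) → Labelling ℤ,
      (∀ l coin c, IsFilling z l coin c ↔ c = F (l, coin)) ∧
      Measurable F ∧ μ = (pathSourceLaw p z).map F := by
  have hD := hu.isInterface_belowPath hz
  -- Edges off the path get the default `false`, which the filling never reads.
  let E : (ℤ → Bool) × (ℤ × ℤ → Bool) → Site → Bool := fun a =>
    Sum.elim (Function.extend (pathEdge z) a.1 fun _ => false) a.2
  have hE : Measurable E := by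
    refine measurable_pi_iff.2 fun s => ?_
    rcases s with e | s
    · by_cases h : ∃ i, pathEdge z i = e
      · obtain ⟨i, rfl⟩ := h
        simp only [E, Sum.elim_inl, hz.pathEdge_injective.extend_apply]
        fun_prop
      · simp only [E, Sum.elim_inl, Function.extend_apply' _ _ _ h]
        fun_prop
    · simp only [E, Sum.elim_inr]
      fun_prop
  have hF : ∀ l coin c, IsFilling z l coin c ↔ c = (hD.fill ∘ E) (l, coin) := by
    intro l coin c
    rw [Function.comp_apply, ← hD.isFilledFrom_iff, ← hu.isFilling_iff hz]
    simp only [E, Sum.elim_inl, Sum.elim_inr, hz.pathEdge_injective.extend_apply]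
  -- Forgetting the labels off the path does not change the filling, since the rules of `IsFilling`
  -- mention only path labels and coins and have a unique solution.
  have hcomp : (hD.fill ∘ E) ∘
      (fun ω : Site → Bool => (fun i => ω (.inl (pathEdge z i)), fun s => ω (.inr s))) =
      hD.fill := by
    funext ω
    exact ((hF _ _ _).1 ((hu.isFilling_iff hz).2 (hD.isFilledFrom_fill ω))).symm
  refine ⟨hD.fill ∘ E, hF, hD.measurable_fill.comp hE, ?_⟩
  rw [← sourceLaw_map_pathSource p hz,
    Measure.map_map (hD.measurable_fill.comp hE) (by fun_prop), hcomp]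
  exact hμ.unique (hD.isPlaneExtension_law p)

end Unbounded

end Path

end CocycleExample

open CocycleExample in
theorem lemma4p3 (p : unitInterval) (hp0 : 0 < p) (hp1 : p < 1) :
    (∃! μ : Measure (Labelling ℤ), IsPlaneExtension p μ) ∧
    ∀ μ : Measure (Labelling ℤ), IsPlaneExtension p μ →
      ∀ z : ℤ → ℤ × ℤ, IsDirectedPath z →
        iIndepFun (fun (i : ℤ) (c : Labelling ℤ) => c (pathEdge z i)) μ ∧
        (IsUnboundedPath z →
          ∃ F : (ℤ → Bool) × (ℤ × ℤ → Bool) → Labelling ℤ,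
            (∀ l coin c, IsFilling z l coin c ↔ c = F (l, coin)) ∧
            Measurable F ∧
            μ = (pathSourceLaw p z).map F) := by
  refine ⟨existsUnique_isPlaneExtension p, fun μ hμ z hz => ⟨hμ.iIndepFun_pathEdge hz, fun hu => ?_⟩⟩
  exact hμ.exists_fill_path hz hu
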